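/- All graphs are finite, undirected and simple. An odd cycle transversal (OCT) of a graph $H$ is a set $S \subseteq V(H)$ such that $H - S$ is bipartite; $\mathrm{oct}(H)$ is the minimum size of an OCT of $H$, and an OCT of that size is optimal. An odd cycle cut (OCC) of a graph $G$ is a partition $(X_B, X_C, X_R)$ of $V(G)$ (parts may be empty) such that $G[X_B]$ is bipartite, no edge joins $X_B$ and $X_R$, and $X_C \cup X_B \neq \emptyset$; $X_C$ is its head and $|X_C|$ its width. For an integer $z \ge 0$, an OCC $(A_B, A_C, A_R)$ is $z$-tight if $|A_C| = \mathrm{oct}(G[A_C \cup A_B])$ and $G[A_C \cup A_B]$ has a subgraph $H$ such that $A_C$ is an optimal OCT of $H$ and $|A_C \cap V(H')| \le z$ for every connected component $H'$ of $H$. Marking step. Given a graph $G$ and an OCC $(X_B, X_C, X_R)$ of $G$, choose a proper 2-coloring $f \colon X_B \to \{0,1\}$ of $G[X_B]$. Let $G'$ be the graph obtained from a copy of $G[X_B]$ by adding, for each $v \in X_C$, two new vertices $v^{(0)}, v^{(1)}$ and, for each neighbor $u \in X_B$ of $v$, the edge $v^{(f(u))}u$. Let $T = \{v^{(i)} \mid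 v \in X_C,\ i \in \{0,1\}\}$, so that $|T| = 2|X_C|$. Choose a set $Z \subseteq V(G')$ with the following property: for every partition $(T_0, T_1, T_2, T_3, T_X)$ of $T$ into five possibly empty parts, if the problem "find a set $S \subseteq V(G') \setminus (T_1 \cup T_2 \cup T_3)$ such that for all $1 \le i < j \le 3$ no connected component of $(G' - T_X) - S$ contains both a vertex of $T_i$ and a vertex of $T_j$" has a solution of size at most $|T|$, then $Z$ contains a minimum-size solution of it. The marked set is $B^* = Z \cap X_B$. Statement. Let $G$ be a graph, let $(X_B, X_C, X_R)$ be an OCC of $G$, let $B^* \subseteq X_B$ be any set marked by the marking step for $G$ and $(X_B, X_C, X_R)$, and let $z \ge 0$ be an integer. If $G$ has a $z$-tight OCC $(A_B, A_C, A_R)$, then $G$ has a $z$-tight OCC $(A_B^*, A_C^*, A_R^*)$ with $|A_C^*| = |A_C|$ and $A_C^* \cap X_B \subseteq B^*$. -/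

import Mathlib

namespace OddCycleCut

open SimpleGraph

universe u

section Transversals

variable {V : Type u} {G : SimpleGraph V}

/-- `S` is an odd cycle transversal of the graph `H` (a subgraph of some ambient graph `G`):
a set of vertices of `H` such that `H - S` is bipartite. -/
def IsOCT (H : G.Subgraph) (S : Set V) : Prop :=
  S ⊆ H.verts ∧ (H.deleteVerts S).coe.IsBipartite

/-- `S` is an odd cycle transversal of `H` of minimum size. -/
def IsOptimalOCT (H : G.Subgraph) (S : Set V) : Prop :=
  IsOCT H S ∧ ∀ S' : Set V, IsOCT H S' → S.ncard ≤ S'.ncard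

/-- The minimum size of an odd cycle transversal of `H`. -/
noncomputable def oct (H : G.Subgraph) : ℕ :=
  sInf {n : ℕ | ∃ S : Set V, IsOCT H S ∧ S.ncard = n}

/-- `H` is an `X`-certificate of order `z`: `X` is an optimal odd cycle transversal of `H`, and
every connected component of `H` contains at most `z` vertices of `X`. -/
def IsCertificate (H : G.Subgraph) (X : Set V) (z : ℕ) : Prop :=
  IsOptimalOCT H X ∧
    ∀ c : H.coe.ConnectedComponent, (X ∩ (Subtype.val '' c.supp)).ncard ≤ z

end Transversals

section Cuts

variable {V : Type u} (G : SimpleGraph V)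

/-- `(XB, XC, XR)` is an odd cycle cut of `G`: a partition of the vertex set (parts may be empty)
such that `G[XB]` is bipartite, no edge joins `XB` and `XR`, and `XC ∪ XB` is not empty.
Its head is `XC` and its width is `|XC|`. -/
structure IsOCC (XB XC XR : Set V) : Prop where
  disjoint_BC : Disjoint XB XC
  disjoint_BR : Disjoint XB XR
  disjoint_CR : Disjoint XC XR
  cover : XB ∪ XC ∪ XR = Set.univ
  bipartite : (G.induce XB).IsBipartite
  no_edge : ∀ b ∈ XB, ∀ r ∈ XR, ¬ G.Adj b r
  nonempty : (XC ∪ XB).Nonempty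

/-- The odd cycle cut `(AB, AC, AR)` is tight: `|AC| = oct(G[AC ∪ AB])`. -/
structure IsTightOCC (AB AC AR : Set V) : Prop extends IsOCC G AB AC AR where
  tight : AC.ncard = oct ((⊤ : G.Subgraph).induce (AC ∪ AB))

/-- The tight odd cycle cut `(AB, AC, AR)` has order `z`: the graph `G[AC ∪ AB]` contains an
`AC`-certificate of order `z`. -/
structure IsZTightOCC (z : ℕ) (AB AC AR : Set V) : Prop extends IsTightOCC G AB AC AR where
  certificate : ∃ H : G.Subgraph,
    H ≤ (⊤ : G.Subgraph).induce (AC ∪ AB) ∧ IsCertificate H AC z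

end Cuts

section CutCovering

variable {W : Type u}

/-- `X` separates `S` and `T` in `G`: no connected component of `G - X` contains both a vertex of
`S` and a vertex of `T`. The set `X` may intersect `S` and `T`. -/
def Separates (G : SimpleGraph W) (X S T : Set W) : Prop :=
  ∀ (s t : W) (hs : s ∉ X) (ht : t ∉ X), s ∈ S → t ∈ T →
    ¬ (G.induce Xᶜ).Reachable ⟨s, hs⟩ ⟨t, ht⟩

/-- The names of the parts of a generalized `s`-partition `(T₀, T₁, …, Tₛ, T_X)`:
`T₀` is `free`, the `Tᵢ` with `1 ≤ i ≤ s` are `active`, and `T_X` is `deleted`. -/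
inductive PartName (s : ℕ) : Type
  | free : PartName s
  | active (i : Fin s) : PartName s
  | deleted : PartName s

/-- A generalized `s`-partition of the terminal set `T` (an ordered partition whose parts may be
empty) is given by the function that tells in which part each terminal lies. -/
abbrev GenPartition (s : ℕ) (T : Set W) : Type u := T → PartName s

/-- The part named `p` of a generalized partition. -/
def GenPartition.part {s : ℕ} {T : Set W} (τ : GenPartition s T) (p : PartName s) : Set W :=
  {w | ∃ h : w ∈ T, τ ⟨w, h⟩ = p}

/-- `S` is a restricted multiway cut of `τ = (T₀, T₁, …, Tₛ, T_X)` in `G`: a vertex set that is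
disjoint from `T₁ ∪ … ∪ Tₛ` and separates `Tᵢ` from `Tⱼ` in `G - T_X` for all `i ≠ j`. (Removing
`S` from `G - T_X` leaves `G - (S ∪ T_X)`, and the `Tᵢ` are disjoint from `T_X`.) -/
def IsRestrictedMultiwayCut (G : SimpleGraph W) {s : ℕ} {T : Set W} (τ : GenPartition s T)
    (S : Set W) : Prop :=
  (∀ i : Fin s, Disjoint S (τ.part (.active i))) ∧
    ∀ i j : Fin s, i ≠ j →
      Separates G (S ∪ τ.part .deleted) (τ.part (.active i)) (τ.part (.active j))

/-- `S` is a restricted multiway cut of `τ` of minimum size. -/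
def IsMinRestrictedMultiwayCut (G : SimpleGraph W) {s : ℕ} {T : Set W} (τ : GenPartition s T)
    (S : Set W) : Prop :=
  IsRestrictedMultiwayCut G τ S ∧
    ∀ S' : Set W, IsRestrictedMultiwayCut G τ S' → S.ncard ≤ S'.ncard

/-- `Z` is a cut covering set for the terminal set `T` in `G`: it contains a minimum restricted
multiway cut of every generalized `s`-partition of `T` that has a restricted multiway cut of size
at most `|T|`. -/
def IsCutCoveringSet (s : ℕ) (G : SimpleGraph W) (T : Set W) (Z : Set W) : Prop :=
  ∀ τ : GenPartition s T,
    (∃ S : Set W, IsRestrictedMultiwayCut G τ S ∧ S.ncard ≤ T.ncard) →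
      ∃ S ⊆ Z, IsMinRestrictedMultiwayCut G τ S

end CutCovering

section Marking

variable {V : Type u} (G : SimpleGraph V) (XB XC : Set V)

/-- The auxiliary graph of the marking step: a copy of `G[XB]`, together with two new vertices
`v⁽⁰⁾, v⁽¹⁾` for each `v ∈ XC`, where each neighbour `u ∈ XB` of `v` is joined to `v⁽ⁱ⁾` for
`i = f u`. -/
def auxGraph (f : (G.induce XB).Coloring (Fin 2)) : SimpleGraph (XB ⊕ XC × Fin 2) where
  Adj
    | .inl u, .inl u' => G.Adj u u'
    | .inl u, .inr (v, i) => G.Adj v u ∧ i = f u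
    | .inr (v, i), .inl u => G.Adj v u ∧ i = f u
    | .inr _, .inr _ => False
  symm := ⟨by
    rintro (u | ⟨v, i⟩) (u' | ⟨v', i'⟩) h
    · exact G.adj_symm h
    · exact h
    · exact h
    · exact h⟩
  loopless := ⟨by
    rintro (u | ⟨v, i⟩) h
    · exact G.irrefl h
    · exact h⟩

/-- The terminal set `{v⁽ⁱ⁾ | v ∈ XC, i ∈ {0, 1}}` of the auxiliary graph. -/
def auxTerminals : Set (XB ⊕ XC × Fin 2) := Set.range Sum.inr

/-- `B` is a possible output of the marking step for the odd cycle cut `(XB, XC, XR)`: for some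
proper 2-colouring `f` of `G[XB]` and some cut covering set `Z` of the resulting auxiliary graph
(for three-way cuts between its terminals), `B` consists of the vertices of `XB` in `Z`. -/
def IsMarkedSet (B : Set V) : Prop :=
  ∃ (f : (G.induce XB).Coloring (Fin 2)) (Z : Set (XB ⊕ XC × Fin 2)),
    IsCutCoveringSet 3 (auxGraph G XB XC f) (auxTerminals XB XC) Z ∧
      B = {v | ∃ h : v ∈ XB, Sum.inl ⟨v, h⟩ ∈ Z}

end Marking

end OddCycleCut

/-!
Write `P = AC ∩ XB`, and fix proper 2-colourings `f` of `G[XB]` and `g` of `G[AB]` and a certificate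
`H` of `(AB, AC, AR)`. The generalized partition of the terminals that matters deletes `v⁽ⁱ⁾` for
`v ∈ AC`, puts it into the third part for `v ∈ AR`, and for `v ∈ AB` into the first or the second
part according to whether `g v ≠ i` or `g v = i`. For this partition `P` is a restricted multiway
cut: `AB ∩ XB` splits into the vertices where `f` and `g` agree and those where they differ, no edge
joins the two kinds, and no edge joins `AB` and `AR`. Deleting `XC` instead of `P` shows
`|P| ≤ |XC|` (`ncard_head_inter_le`), so the cut covering set contains a minimum cut `S`, with
`|S| ≤ |P|`. The new head is `C = (AC \ XB) ∪ S`.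

A set of vertices of `XB` that separates the first two parts (a *flip cut*) gives, after `f` is
flipped on one side of it, a colouring compatible with `g` (`IsFlipCut.exists_coloring`). Hence it
may replace `P` as part of an odd cycle transversal of `H`, and by optimality of `AC` it has at
least `|P|` elements (`IsFlipCut.ncard_head_le`). For `S` this yields that `C` is again an optimal
odd cycle transversal of `H`.

It remains to see that `H` lies in the bipartite and the head part of the new cut, that is, that
the new remainder contains only vertices of `AR`. Let `A` and `R` be the regions of `XB` that the
first and the third part reach after `S` is deleted, and `B` the set of vertices of `AB` where `f`
and `g` agree. Uncrossing the flip cuts `S` and `P` gives the flip cuts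
`(S ∩ B) ∪ (P ∩ A) ∪ (S ∩ P)` and `(S \ B) ∪ (P \ A)`; from the
latter the elements of `R` may be dropped: `S` separates `R` from the second part, so `R` can be
moved to the side of the first (`IsFlipCut.union_region`). Counting gives
`P ∩ R = ∅` (`ncard_uncross_le`). So `R ∩ AR` is closed under adjacency in `XB \ S`, and
`AR \ (XB \ R)` can serve as the new remainder. The same graph `H` is then a certificate of the
same order, since any two optimal odd cycle transversals of `H` meet each of its components in
equally many vertices (`IsCertificate.of_isOptimalOCT`).
-/

namespace OddCycleCut

open SimpleGraph

universe u

/-! ### Colourings and odd cycle transversals -/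

section Transversals

variable {V : Type u} {G : SimpleGraph V}

theorem isBipartite_induce_iff (X : Set V) :
    (G.induce X).IsBipartite ↔
      ∃ c : V → Fin 2, ∀ u v, G.Adj u v → u ∈ X → v ∈ X → c u ≠ c v := by
  classical
  constructor
  · rintro ⟨c⟩
    refine ⟨fun v => if h : v ∈ X then c ⟨v, h⟩ else 0, fun u v huv hu hv => ?_⟩
    simp only [hu, hv, dif_pos]
    exact c.valid (v := ⟨u, hu⟩) (w := ⟨v, hv⟩) huv
  · rintro ⟨c, hc⟩
    exact ⟨Coloring.mk (fun v => c v) fun {u v} huv => hc u v huv u.2 v.2⟩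

theorem isOCT_iff {H : G.Subgraph} {S : Set V} :
    IsOCT H S ↔ S ⊆ H.verts ∧
      ∃ c : V → Fin 2, ∀ u v, H.Adj u v → u ∉ S → v ∉ S → c u ≠ c v := by
  classical
  refine and_congr_right fun _ => ?_
  constructor
  · rintro ⟨c⟩
    refine ⟨fun v => if h : v ∈ (H.deleteVerts S).verts then c ⟨v, h⟩ else 0,
      fun u v huv hu hv => ?_⟩
    have hu' : u ∈ (H.deleteVerts S).verts := ⟨huv.fst_mem, hu⟩
    have hv' : v ∈ (H.deleteVerts S).verts := ⟨huv.snd_mem, hv⟩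
    simp only [hu', hv', dif_pos]
    refine c.valid (v := ⟨u, hu'⟩) (w := ⟨v, hv'⟩) ?_
    rw [Subgraph.coe_adj, Subgraph.deleteVerts_adj]
    exact ⟨huv.fst_mem, hu, huv.snd_mem, hv, huv⟩
  · rintro ⟨c, hc⟩
    refine ⟨Coloring.mk (fun v => c v) fun {u v} huv => ?_⟩
    rw [Subgraph.coe_adj, Subgraph.deleteVerts_adj] at huv
    exact hc u v huv.2.2.2.2 huv.2.1 huv.2.2.2.1

theorem isOCT_induce_iff {W S : Set V} :
    IsOCT ((⊤ : G.Subgraph).induce W) S ↔ S ⊆ W ∧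
      ∃ c : V → Fin 2, ∀ u v, G.Adj u v → u ∈ W \ S → v ∈ W \ S → c u ≠ c v := by
  simp only [isOCT_iff, Subgraph.induce_verts, Subgraph.induce_adj, Subgraph.top_adj, Set.mem_sdiff]
  refine and_congr_right fun _ => exists_congr fun c => forall₂_congr fun u v => ?_
  tauto

theorem IsOCT.inter_verts {H K : G.Subgraph} (hHK : H ≤ K) {S : Set V} (hS : IsOCT K S) :
    IsOCT H (S ∩ H.verts) := by
  rw [isOCT_iff] at hS ⊢
  obtain ⟨-, c, hc⟩ := hS
  exact ⟨Set.inter_subset_right, c, fun u v huv hu hv => hc u v (hHK.2 huv)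
    (fun h => hu ⟨h, huv.fst_mem⟩) (fun h => hv ⟨h, huv.snd_mem⟩)⟩

/-- Two odd cycle transversals can be mixed along a connected component. -/
theorem IsOCT.swap {H : G.Subgraph} {X Y : Set V} (hX : IsOCT H X) (hY : IsOCT H Y)
    (c : H.coe.ConnectedComponent) :
    IsOCT H ((X \ (Subtype.val '' c.supp)) ∪ (Y ∩ (Subtype.val '' c.supp))) := by
  classical
  rw [isOCT_iff] at hX hY ⊢
  obtain ⟨hX, a, ha⟩ := hX
  obtain ⟨hY, b, hb⟩ := hY
  set C : Set V := Subtype.val '' c.supp with hC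
  have key : ∀ u v, H.Adj u v → u ∈ C → v ∈ C := by
    rintro _ v huv ⟨u, hu, rfl⟩
    refine ⟨⟨v, huv.snd_mem⟩, ?_, rfl⟩
    rw [ConnectedComponent.mem_supp_iff] at hu ⊢
    rw [← hu]
    exact ConnectedComponent.sound
      (Adj.reachable (G := H.coe) (u := ⟨v, huv.snd_mem⟩) (v := u) huv.symm)
  refine ⟨by grind, fun v => if v ∈ C then b v else a v, fun u v huv hu hv => ?_⟩
  have h1 := key u v huv
  have h2 := key v u huv.symm
  have h3 := ha u v huv
  have h4 := hb u v huv
  by_cases hu' : u ∈ C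
  · have hv' := h1 hu'
    simp only [hu', hv', if_true]
    exact h4 (fun h => hu (Or.inr ⟨h, hu'⟩)) (fun h => hv (Or.inr ⟨h, hv'⟩))
  · have hv' : v ∉ C := fun h => hu' (h2 h)
    simp only [hu', hv', if_false]
    exact h3 (fun h => hu (Or.inl ⟨h, hu'⟩)) (fun h => hv (Or.inl ⟨h, hv'⟩))

/-- A certificate stays one, of the same order, for every other optimal odd cycle transversal:
all of them meet each connected component in the same number of vertices. -/
theorem IsCertificate.of_isOptimalOCT [Finite V] {H : G.Subgraph} {X Y : Set V} {z : ℕ}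
    (hX : IsCertificate H X z) (hY : IsOptimalOCT H Y) : IsCertificate H Y z := by
  refine ⟨hY, fun c => le_trans ?_ (hX.2 c)⟩
  have h := hY.2 _ (hY.1.swap hX.1.1 c)
  have h1 := Set.ncard_union_le (Y \ (Subtype.val '' c.supp)) (X ∩ (Subtype.val '' c.supp))
  have h2 := Set.ncard_inter_add_ncard_sdiff_eq_ncard Y (Subtype.val '' c.supp)
  omega

/-- A subgraph for which `X` is optimal certifies `oct = |X|` in the larger graph. -/
theorem oct_induce_eq [Finite V] {W X : Set V} {H : G.Subgraph}
    (hH : H ≤ (⊤ : G.Subgraph).induce W) (hX : IsOptimalOCT H X)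
    (hW : IsOCT ((⊤ : G.Subgraph).induce W) X) :
    oct ((⊤ : G.Subgraph).induce W) = X.ncard := by
  apply le_antisymm
  · exact Nat.sInf_le ⟨X, hW, rfl⟩
  · refine le_csInf ⟨_, X, hW, rfl⟩ ?_
    rintro _ ⟨S, hS, rfl⟩
    exact (hX.2 _ (hS.inter_verts hH)).trans (Set.ncard_le_ncard Set.inter_subset_left)

end Transversals

/-! ### Flip cuts -/

section FlipCuts

variable {V : Type u}

/-- For a 2-colouring `f` of `XB` and a 2-colouring `g` of `AB`, the set `M` is a cut between the
part `U` of `XB`, on which `f` is compatible with `g`, and the rest of `XB`, on which the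
colouring opposite to `f` is compatible with `g`. The compatibility concerns the edges between
`XB` and `XC ∩ AB`. -/
structure IsFlipCut (G : SimpleGraph V) (XB XC AB : Set V) (f g : V → Fin 2) (M U : Set V) :
    Prop where
  mem_of_ne : ∀ v ∈ XC, v ∈ AB → ∀ u ∈ XB, G.Adj v u → g v ≠ f u → u ∉ M → u ∈ U
  ne_of_mem : ∀ v ∈ XC, v ∈ AB → ∀ u ∈ XB, G.Adj v u → u ∈ U → g v ≠ f u
  closed : ∀ u ∈ XB, ∀ v ∈ XB, G.Adj u v → u ∈ U → v ∉ M → v ∈ U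

variable {G : SimpleGraph V} {XB XC XR AB AC AR : Set V} {f g : V → Fin 2}

/-- A flip cut yields a proper colouring: `f` on `U`, its opposite on the rest of `XB`, and `g`
outside `XB`. -/
theorem IsFlipCut.exists_coloring {M U : Set V} (h : IsFlipCut G XB XC AB f g M U)
    (hX : IsOCC G XB XC XR) (hf : ∀ u v, G.Adj u v → u ∈ XB → v ∈ XB → f u ≠ f v)
    (hg : ∀ u v, G.Adj u v → u ∈ AB → v ∈ AB → g u ≠ g v) :
    ∃ c : V → Fin 2, ∀ u v, G.Adj u v → u ∈ (XB ∪ AB) \ M → v ∈ (XB ∪ AB) \ M → c u ≠ c v := by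
  classical
  let c : V → Fin 2 := fun v => if v ∈ XB then (if v ∈ U then f v else 1 - f v) else g v
  have mixed : ∀ u v, G.Adj v u → u ∈ XB → u ∉ M → v ∉ XB → v ∈ AB → c u ≠ c v := by
    intro u v huv hu huM hv hvA
    have hvC : v ∈ XC := by
      have h1 : v ∈ XB ∪ XC ∪ XR := hX.cover ▸ Set.mem_univ v
      have h2 := hX.no_edge u hu v
      have h3 := huv.symm
      simp only [Set.mem_union] at h1
      tauto
    have h1 := h.mem_of_ne v hvC hvA u hu huv
    have h2 := h.ne_of_mem v hvC hvA u hu huv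
    simp only [c, hu, hv, if_true, if_false]
    split_ifs with hU
    · exact (h2 hU).symm
    · have h3 : g v = f u := by by_contra h3; exact hU (h1 h3 huM)
      rw [h3]; generalize f u = a; revert a; decide
  refine ⟨c, fun u v huv hu hv => ?_⟩
  by_cases huB : u ∈ XB <;> by_cases hvB : v ∈ XB
  · have h1 := h.closed u huB v hvB huv
    have h2 := h.closed v hvB u huB huv.symm
    have h3 := hf u v huv huB hvB
    have h4 : u ∈ U ↔ v ∈ U := ⟨fun h => h1 h hv.2, fun h => h2 h hu.2⟩
    simp only [c, huB, hvB, if_true, h4]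
    split_ifs
    · exact h3
    · revert h3; generalize f u = a; generalize f v = b; revert a b; decide
  · exact mixed u v huv.symm huB hu.2 hvB (hv.1.resolve_left hvB)
  · exact (mixed v u huv hvB hv.2 huB (hu.1.resolve_left huB)).symm
  · simp only [c, huB, hvB, if_false]
    exact hg u v huv (hu.1.resolve_left huB) (hv.1.resolve_left hvB)

theorem IsFlipCut.inter {S P A B : Set V} (hS : IsFlipCut G XB XC AB f g S A)
    (hP : IsFlipCut G XB XC AB f g P B) :
    IsFlipCut G XB XC AB f g ((S ∩ B) ∪ (P ∩ A) ∪ (S ∩ P)) (A ∩ B) where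
  mem_of_ne v hv hvA u hu huv hne hM := by
    have h1 := hS.mem_of_ne v hv hvA u hu huv hne
    have h2 := hP.mem_of_ne v hv hvA u hu huv hne
    simp only [Set.mem_union, Set.mem_inter_iff] at *
    tauto
  ne_of_mem v hv hvA u hu huv hU := hS.ne_of_mem v hv hvA u hu huv hU.1
  closed u hu v hv huv hU hM := by
    have h1 := hS.closed u hu v hv huv hU.1
    have h2 := hP.closed u hu v hv huv hU.2
    simp only [Set.mem_union, Set.mem_inter_iff] at *
    tauto

/-- The union of two flip cuts, where moreover a region `R` that is closed off by `S` is moved to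
the side of the union, so that its vertices need not be cut. -/
theorem IsFlipCut.union_region {S P A B R : Set V} (hS : IsFlipCut G XB XC AB f g S A)
    (hP : IsFlipCut G XB XC AB f g P B)
    (hR : ∀ u ∈ XB, ∀ v ∈ XB, G.Adj u v → u ∈ R → v ∉ S → v ∈ R)
    (hRne : ∀ v ∈ XC, v ∈ AB → ∀ u ∈ XB, G.Adj v u → u ∈ R → g v ≠ f u) :
    IsFlipCut G XB XC AB f g ((S \ B) ∪ (P \ (A ∪ R))) (A ∪ B ∪ R) where
  mem_of_ne v hv hvA u hu huv hne hM := by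
    have h1 := hS.mem_of_ne v hv hvA u hu huv hne
    simp only [Set.mem_union, Set.mem_sdiff] at *
    tauto
  ne_of_mem v hv hvA u hu huv hU := by
    have h1 := hS.ne_of_mem v hv hvA u hu huv
    have h2 := hP.ne_of_mem v hv hvA u hu huv
    have h3 := hRne v hv hvA u hu huv
    simp only [Set.mem_union] at hU
    tauto
  closed u hu v hv huv hU hM := by
    have h1 := hS.closed u hu v hv huv
    have h2 := hP.closed u hu v hv huv
    have h3 := hR u hu v hv huv
    simp only [Set.mem_union, Set.mem_sdiff] at *
    tauto

/-- The submodular count behind uncrossing: elements of `P ∩ R` occur on the right but in neither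
of the two uncrossed sets. -/
theorem ncard_uncross_le [Finite V] {S P A B R : Set V} (hSA : Disjoint S A) (hPB : Disjoint P B)
    (hAR : Disjoint A R) (hSR : Disjoint S R) :
    ((S ∩ B) ∪ (P ∩ A) ∪ (S ∩ P)).ncard + ((S \ B) ∪ (P \ (A ∪ R))).ncard + (P ∩ R).ncard ≤
      S.ncard + P.ncard := by
  set M := (S ∩ B) ∪ (P ∩ A) ∪ (S ∩ P) with hM
  set N := (S \ B) ∪ (P \ (A ∪ R)) with hN
  rw [Set.disjoint_left] at hSA hPB hAR hSR
  have h1 := Set.ncard_union_add_ncard_inter M N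
  have h2 := Set.ncard_union_add_ncard_inter S P
  have h3 : (M ∩ N).ncard ≤ (S ∩ P).ncard := Set.ncard_le_ncard (by
    intro x
    have := @hSA x; have := @hPB x
    simp only [hM, hN, Set.mem_union, Set.mem_inter_iff, Set.mem_sdiff]
    tauto)
  have h4 : Disjoint (M ∪ N) (P ∩ R) := by
    rw [Set.disjoint_left]
    intro x
    have := @hAR x; have := @hSR x
    simp only [hM, hN, Set.mem_union, Set.mem_inter_iff, Set.mem_sdiff]
    tauto
  have h5 := Set.ncard_union_eq h4
  have h6 : (M ∪ N ∪ P ∩ R).ncard ≤ (S ∪ P).ncard := Set.ncard_le_ncard (by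
    intro x
    simp only [hM, hN, Set.mem_union, Set.mem_inter_iff, Set.mem_sdiff]
    tauto)
  omega

/-- The set `AC ∩ XB` is a flip cut; its side consists of the vertices on which `f` and `g`
agree. -/
theorem isFlipCut_head (hA : IsOCC G AB AC AR)
    (hf : ∀ u v, G.Adj u v → u ∈ XB → v ∈ XB → f u ≠ f v)
    (hg : ∀ u v, G.Adj u v → u ∈ AB → v ∈ AB → g u ≠ g v) :
    IsFlipCut G XB XC AB f g (AC ∩ XB) {u | u ∈ AB ∧ g u = f u} := by
  have nbr : ∀ u v, G.Adj u v → u ∈ AB → v ∉ AC → v ∈ AB := by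
    intro u v huv hu hv
    have h1 : v ∈ AB ∪ AC ∪ AR := hA.cover ▸ Set.mem_univ v
    have h2 := hA.no_edge u hu v
    simp only [Set.mem_union] at h1
    tauto
  refine ⟨fun v _ hvA u hu huv hne hM => ?_, fun v _ hvA u hu huv hU => ?_,
    fun u hu v hv huv hU hM => ?_⟩
  · have huA := nbr v u huv hvA fun h => hM ⟨h, hu⟩
    have h1 := hg v u huv hvA huA
    exact ⟨huA, by omega⟩
  · have h1 := hg v u huv hvA hU.1
    rwa [hU.2] at h1
  · have hvA := nbr u v huv hU.1 fun h => hM ⟨h, hv⟩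
    have h1 := hg u v huv hU.1 hvA
    have h2 := hf u v huv hu hv
    have h3 := hU.2
    exact ⟨hvA, by omega⟩

/-- In a certificate for `AC`, replacing `AC ∩ XB` by a flip cut gives an odd cycle
transversal. -/
theorem IsFlipCut.isOCT {M U : Set V} (h : IsFlipCut G XB XC AB f g M U)
    (hX : IsOCC G XB XC XR) (hf : ∀ u v, G.Adj u v → u ∈ XB → v ∈ XB → f u ≠ f v)
    (hg : ∀ u v, G.Adj u v → u ∈ AB → v ∈ AB → g u ≠ g v)
    {H : G.Subgraph} (hH : H ≤ (⊤ : G.Subgraph).induce (AC ∪ AB)) :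
    IsOCT H (((AC \ XB) ∪ M) ∩ H.verts) := by
  obtain ⟨c, hc⟩ := h.exists_coloring hX hf hg
  refine isOCT_iff.2 ⟨Set.inter_subset_right, c, fun u v huv hu hv => ?_⟩
  have aux : ∀ w ∈ H.verts, w ∉ ((AC \ XB) ∪ M) ∩ H.verts → w ∈ (XB ∪ AB) \ M := by
    intro w hw hw'
    have h1 : w ∈ AC ∪ AB := hH.1 hw
    simp only [Set.mem_union, Set.mem_sdiff, Set.mem_inter_iff] at *
    tauto
  exact hc u v huv.adj_sub (aux u huv.fst_mem hu) (aux v huv.snd_mem hv)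

theorem IsFlipCut.ncard_head_le [Finite V] {M U : Set V} (h : IsFlipCut G XB XC AB f g M U)
    (hX : IsOCC G XB XC XR) (hf : ∀ u v, G.Adj u v → u ∈ XB → v ∈ XB → f u ≠ f v)
    (hg : ∀ u v, G.Adj u v → u ∈ AB → v ∈ AB → g u ≠ g v)
    {H : G.Subgraph} (hH : H ≤ (⊤ : G.Subgraph).induce (AC ∪ AB)) (hAC : IsOptimalOCT H AC) :
    (AC ∩ XB).ncard ≤ M.ncard := by
  have h1 := hAC.2 _ (h.isOCT hX hf hg hH)
  have h2 := Set.ncard_le_ncard (Set.inter_subset_left (s := (AC \ XB) ∪ M) (t := H.verts))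
  have h3 := Set.ncard_union_le (AC \ XB) M
  have h4 := Set.ncard_inter_add_ncard_sdiff_eq_ncard AC XB
  omega

/-- The head of a certified cut meets `XB` in at most `|XC|` vertices, since deleting `XC` would
separate `XB` from the rest of the certificate. -/
theorem ncard_head_inter_le [Finite V] (hX : IsOCC G XB XC XR)
    (hf : ∀ u v, G.Adj u v → u ∈ XB → v ∈ XB → f u ≠ f v)
    (hg : ∀ u v, G.Adj u v → u ∈ AB → v ∈ AB → g u ≠ g v)
    {H : G.Subgraph} (hH : H ≤ (⊤ : G.Subgraph).induce (AC ∪ AB)) (hAC : IsOptimalOCT H AC) :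
    (AC ∩ XB).ncard ≤ XC.ncard := by
  classical
  have key : IsOCT H (((AC \ XB) ∪ XC) ∩ H.verts) := by
    refine isOCT_iff.2 ⟨Set.inter_subset_right, fun v => if v ∈ XB then f v else g v,
      fun u v huv hu hv => ?_⟩
    have notC : ∀ w ∈ H.verts, w ∉ ((AC \ XB) ∪ XC) ∩ H.verts → w ∉ XC :=
      fun w hw hw' h => hw' ⟨Or.inr h, hw⟩
    have memA : ∀ w ∈ H.verts, w ∉ ((AC \ XB) ∪ XC) ∩ H.verts → w ∉ XB → w ∈ AB :=
      fun w hw hw' h => (hH.1 hw).resolve_left fun h' => hw' ⟨Or.inl ⟨h', h⟩, hw⟩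
    have memB : ∀ w w', G.Adj w w' → w ∈ XB → w' ∉ XC → w' ∈ XB := by
      intro w w' hww' hw hw'
      have h1 : w' ∈ XB ∪ XC ∪ XR := hX.cover ▸ Set.mem_univ w'
      have h2 := hX.no_edge w hw w'
      simp only [Set.mem_union] at h1
      tauto
    by_cases huB : u ∈ XB
    · have hvB := memB u v huv.adj_sub huB (notC v huv.snd_mem hv)
      simpa only [huB, hvB, if_true] using hf u v huv.adj_sub huB hvB
    · have hvB : v ∉ XB :=
        fun h => huB (memB v u huv.adj_sub.symm h (notC u huv.fst_mem hu))
      simpa only [huB, hvB, if_false] using hg u v huv.adj_sub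
        (memA u huv.fst_mem hu huB) (memA v huv.snd_mem hv hvB)
  have h1 := hAC.2 _ key
  have h2 := Set.ncard_le_ncard (Set.inter_subset_left (s := (AC \ XB) ∪ XC) (t := H.verts))
  have h3 := Set.ncard_union_le (AC \ XB) XC
  have h4 := Set.ncard_inter_add_ncard_sdiff_eq_ncard AC XB
  omega

end FlipCuts

/-! ### Multiway cuts of the auxiliary graph -/

section Regions

variable {V : Type u} {G : SimpleGraph V} {XB XC : Set V}

/-- The generalized partition of the terminals in which `v⁽ⁱ⁾` lies in the part `p v i`. -/
def labelPartition (XB XC : Set V) (p : V → Fin 2 → PartName 3) :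
    GenPartition 3 (auxTerminals XB XC) := fun t =>
  match t.1 with
  | .inl _ => .free
  | .inr (v, i) => p v i

theorem inr_mem_part {p : V → Fin 2 → PartName 3} {v : XC} {i : Fin 2} {q : PartName 3} :
    (Sum.inr (v, i) : XB ⊕ XC × Fin 2) ∈ (labelPartition XB XC p).part q ↔ p v i = q :=
  ⟨fun ⟨_, h⟩ => h, fun h => ⟨⟨_, rfl⟩, h⟩⟩

theorem inl_notMem_part {p : V → Fin 2 → PartName 3} {u : XB} {q : PartName 3} :
    (Sum.inl u : XB ⊕ XC × Fin 2) ∉ (labelPartition XB XC p).part q := by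
  rintro ⟨⟨x, hx⟩, -⟩
  cases hx

/-- A restricted multiway cut `S` of the auxiliary graph gives disjoint regions `R i ⊆ XB`, the
sets of vertices that the terminals of the `i`-th active part reach: they avoid `S`, are closed
under adjacency outside `S`, contain the neighbours outside `S` of their own terminals, and have no
neighbour among the active terminals of another part. -/
theorem exists_regions {f : V → Fin 2} {c : (G.induce XB).Coloring (Fin 2)}
    (hc : ∀ u : XB, c u = f u) {p : V → Fin 2 → PartName 3} {S : Set (XB ⊕ XC × Fin 2)}
    (hS : IsRestrictedMultiwayCut (auxGraph G XB XC c) (labelPartition XB XC p) S) :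
    ∃ R : Fin 3 → Set V,
      (∀ i, R i ⊆ XB) ∧
      (∀ i, Disjoint {v | ∃ h : v ∈ XB, Sum.inl ⟨v, h⟩ ∈ S} (R i)) ∧
      (∀ i, ∀ u ∈ XB, ∀ v ∈ XB, G.Adj u v → u ∈ R i →
        v ∉ {v | ∃ h : v ∈ XB, Sum.inl ⟨v, h⟩ ∈ S} → v ∈ R i) ∧
      (∀ i, ∀ v ∈ XC, ∀ u ∈ XB, G.Adj v u → p v (f u) = .active i →
        u ∉ {v | ∃ h : v ∈ XB, Sum.inl ⟨v, h⟩ ∈ S} → u ∈ R i) ∧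
      (∀ i j, ∀ v ∈ XC, ∀ u ∈ XB, G.Adj v u → p v (f u) = .active j → u ∈ R i → i = j) ∧
      (∀ i j, i ≠ j → Disjoint (R i) (R j)) := by
  set D := S ∪ (labelPartition XB XC p).part .deleted with hD
  let R : Fin 3 → Set V := fun i => {u | ∃ (hu : u ∈ XB)
    (hn : (Sum.inl ⟨u, hu⟩ : XB ⊕ XC × Fin 2) ∈ Dᶜ) (t : XB ⊕ XC × Fin 2) (ht : t ∈ Dᶜ),
      t ∈ (labelPartition XB XC p).part (.active i) ∧
      ((auxGraph G XB XC c).induce Dᶜ).Reachable ⟨t, ht⟩ ⟨_, hn⟩}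
  have inl_mem : ∀ u (hu : u ∈ XB), u ∉ {v | ∃ h : v ∈ XB, Sum.inl ⟨v, h⟩ ∈ S} →
      (Sum.inl ⟨u, hu⟩ : XB ⊕ XC × Fin 2) ∈ Dᶜ := by
    rintro u hu h (h' | h')
    · exact h ⟨hu, h'⟩
    · exact inl_notMem_part h'
  have inr_mem : ∀ v (hv : v ∈ XC) (k : Fin 2) (i : Fin 3), p v k = .active i →
      (Sum.inr (⟨v, hv⟩, k) : XB ⊕ XC × Fin 2) ∈ Dᶜ := by
    rintro v hv k i h (h' | h')
    · exact Set.disjoint_left.1 (hS.1 i) h' (inr_mem_part.2 h)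
    · have h2 := inr_mem_part.1 h'
      simp only at h2
      rw [h] at h2
      cases h2
  refine ⟨R, fun i u hu => hu.1, fun i => ?_, ?_, ?_, ?_, ?_⟩
  · rw [Set.disjoint_left]
    rintro u ⟨hu, huS⟩ ⟨_, hn, _⟩
    exact hn (Or.inl huS)
  · rintro i u hu v hv huv ⟨_, hn, t, ht, hti, hr⟩ hvS
    refine ⟨hv, inl_mem v hv hvS, t, ht, hti, hr.trans (Adj.reachable ?_)⟩
    exact huv
  · intro i v hv u hu huv hp huS
    refine ⟨hu, inl_mem u hu huS, _, inr_mem v hv _ i hp, inr_mem_part.2 hp, Adj.reachable ?_⟩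
    exact ⟨huv, (hc ⟨u, hu⟩).symm⟩
  · rintro i j v hv u hu huv hp ⟨_, hn, t, ht, hti, hr⟩
    by_contra hij
    refine hS.2 i j hij t _ ht (inr_mem v hv _ j hp) hti (inr_mem_part.2 hp)
      (hr.trans (Adj.reachable ?_))
    exact ⟨huv, (hc ⟨u, hu⟩).symm⟩
  · intro i j hij
    rw [Set.disjoint_left]
    rintro u ⟨_, hn, t, ht, hti, hr⟩ ⟨_, _, t', ht', hti', hr'⟩
    exact hS.2 i j hij t t' ht ht' hti hti' (hr.trans hr'.symm)

/-- A set `P` of vertices of `XB` is a restricted multiway cut of the auxiliary graph as soon as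
`XB` can be labelled consistently with the terminals, and along all edges that avoid `P`. -/
theorem isRestrictedMultiwayCut_of_label {f : V → Fin 2} {c : (G.induce XB).Coloring (Fin 2)}
    (hc : ∀ u : XB, c u = f u) {p : V → Fin 2 → PartName 3} {P : Set V} {l : V → Fin 3}
    (hl : ∀ u ∈ XB, ∀ v ∈ XB, G.Adj u v → u ∉ P → v ∉ P → l u = l v)
    (hp : ∀ v ∈ XC, ∀ u ∈ XB, G.Adj v u → u ∉ P → p v (f u) = .active (l u) ∨
      p v (f u) = .deleted) :
    IsRestrictedMultiwayCut (auxGraph G XB XC c) (labelPartition XB XC p)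
      {x | ∃ u : XB, x = Sum.inl u ∧ u.1 ∈ P} := by
  refine ⟨fun i => ?_, fun i j hij s t hs ht hsi htj hr => hij ?_⟩
  · rw [Set.disjoint_left]
    rintro _ ⟨u, rfl, -⟩ h
    exact inl_notMem_part h
  · -- Labels of the auxiliary graph that are constant along walks avoiding the cut.
    let L : XB ⊕ XC × Fin 2 → Option (Fin 3) := fun x =>
      match x with
      | .inl u => some (l u)
      | .inr (v, k) => match p v k with
        | .active i => some i
        | _ => none
    have hL : ∀ x i, x ∈ (labelPartition XB XC p).part (.active i) → L x = some i := by
      rintro (u | ⟨v, k⟩) i hx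
      · exact (inl_notMem_part hx).elim
      · have := inr_mem_part.1 hx
        simp only [L, this]
    have step : ∀ x y, (auxGraph G XB XC c).Adj x y →
        x ∉ {x | ∃ u : XB, x = Sum.inl u ∧ u.1 ∈ P} ∪ (labelPartition XB XC p).part .deleted →
        y ∉ {x | ∃ u : XB, x = Sum.inl u ∧ u.1 ∈ P} ∪ (labelPartition XB XC p).part .deleted →
        L x = L y := by
      have mixed : ∀ (u : XB) (v : XC) (k : Fin 2), G.Adj v u → k = c u → u.1 ∉ P →
          (Sum.inr (v, k) : XB ⊕ XC × Fin 2) ∉ (labelPartition XB XC p).part .deleted →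
          L (.inr (v, k)) = L (.inl u) := by
        rintro u v _ huv rfl hu hv
        rw [inr_mem_part] at hv
        rcases hp v v.2 u u.2 huv hu with h | h
        · rw [← hc] at h
          simp only [L, h]
        · rw [← hc] at h
          exact (hv h).elim
      rintro (u | ⟨v, k⟩) (u' | ⟨v', k'⟩) hxy hx hy
      · simp only [L]
        rw [hl u u.2 u' u'.2 hxy (fun h => hx (Or.inl ⟨u, rfl, h⟩))
          (fun h => hy (Or.inl ⟨u', rfl, h⟩))]
      · exact (mixed u v' k' hxy.1 hxy.2 (fun h => hx (Or.inl ⟨u, rfl, h⟩))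
          (fun h => hy (Or.inr h))).symm
      · exact mixed u' v k hxy.1 hxy.2 (fun h => hy (Or.inl ⟨u', rfl, h⟩))
          (fun h => hx (Or.inr h))
      · exact hxy.elim
    obtain ⟨w⟩ := hr
    have walk : ∀ a b (w : ((auxGraph G XB XC c).induce
        ({x | ∃ u : XB, x = Sum.inl u ∧ u.1 ∈ P} ∪
          (labelPartition XB XC p).part .deleted)ᶜ).Walk a b), L a = L b := by
      intro a b w
      induction w with
      | nil => rfl
      | @cons a b _ h _ ih => exact (step a b h a.2 b.2).trans ih
    have := walk _ _ w
    simp only at this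
    rw [hL s i hsi, hL t j htj] at this
    exact Option.some.inj this

end Regions

end OddCycleCut

/-! ### Replacing the head of a tight odd cycle cut -/

open OddCycleCut in
theorem mainTheorem7 {V : Type*} [Finite V] (G : SimpleGraph V)
    (XB XC XR : Set V) (hX : OddCycleCut.IsOCC G XB XC XR)
    (Bstar : Set V) (hB : OddCycleCut.IsMarkedSet G XB XC Bstar)
    (z : ℕ) (AB AC AR : Set V) (hA : OddCycleCut.IsZTightOCC G z AB AC AR) :
      ∃ AB' AC' AR' : Set V, OddCycleCut.IsZTightOCC G z AB' AC' AR' ∧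
        AC'.ncard = AC.ncard ∧ AC' ∩ XB ⊆ Bstar := by
  classical
  obtain ⟨c, Z, hZ, rfl⟩ := hB
  obtain ⟨H, hH, hcert⟩ := hA.certificate
  have hAO : IsOCC G AB AC AR := hA.toIsOCC
  obtain ⟨g, hg⟩ := (isBipartite_induce_iff AB).1 hAO.bipartite
  let f : V → Fin 2 := fun v => if h : v ∈ XB then c ⟨v, h⟩ else 0
  have hc : ∀ u : XB, c u = f u := fun u => by simp only [f, u.2, dif_pos]
  have hf : ∀ u v, G.Adj u v → u ∈ XB → v ∈ XB → f u ≠ f v := by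
    intro u v huv hu hv
    rw [← hc ⟨u, hu⟩, ← hc ⟨v, hv⟩]
    exact c.valid (v := ⟨u, hu⟩) (w := ⟨v, hv⟩) huv
  have cover : ∀ v, v ∈ AB ∨ v ∈ AC ∨ v ∈ AR := fun v => by
    have h1 : v ∈ AB ∪ AC ∪ AR := hAO.cover ▸ Set.mem_univ v
    simp only [Set.mem_union] at h1
    tauto
  have hBR : ∀ v ∈ AB, v ∉ AR := fun v hv => Set.disjoint_left.1 hAO.disjoint_BR hv
  have hBC : ∀ v ∈ AB, v ∉ AC := fun v hv => Set.disjoint_left.1 hAO.disjoint_BC hv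
  have hCR : ∀ v ∈ AC, v ∉ AR := fun v hv => Set.disjoint_left.1 hAO.disjoint_CR hv
  set P := AC ∩ XB with hPdef
  -- For `v ∈ AB`, a neighbour of `v⁽ⁱ⁾` in `XB ∩ AB` has `f`-colour `i` and a `g`-colour different
  -- from `g v`, so `f` and `g` agree there exactly if `g v ≠ i`.
  let p : V → Fin 2 → PartName 3 := fun v i =>
    if v ∈ AC then .deleted else if v ∈ AR then .active 2
    else if g v ≠ i then .active 0 else .active 1
  have hpB0 : ∀ v ∈ AB, ∀ i, g v ≠ i → p v i = .active 0 := fun v hv i hi => by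
    simp only [p, hBC v hv, hBR v hv, if_false, if_pos hi]
  have hpB1 : ∀ v ∈ AB, ∀ i, g v = i → p v i = .active 1 := fun v hv i hi => by
    simp only [p, hBC v hv, hBR v hv, if_false, if_neg (not_not.2 hi)]
  have hpR : ∀ v ∈ AR, ∀ i, p v i = .active 2 := fun v hv i => by
    have h : v ∉ AC := fun h => hCR v h hv
    simp only [p, h, hv, if_false, if_true]
  have hpC : ∀ v ∈ AC, ∀ i, p v i = .deleted := fun v hv i => by
    simp only [p, hv, if_true]
  have hPcut : IsRestrictedMultiwayCut (auxGraph G XB XC c) (labelPartition XB XC p)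
      {x | ∃ u : XB, x = Sum.inl u ∧ u.1 ∈ P} := by
    have hl : ∀ u v, G.Adj u v → u ∈ AB → v ∉ AC → v ∈ AB := fun u v huv hu hv => by
      have h1 := hAO.no_edge u hu v
      have h2 := cover v
      tauto
    refine isRestrictedMultiwayCut_of_label hc
      (l := fun u => if u ∈ AR then 2 else if g u = f u then 0 else 1) ?_ ?_
    · intro u hu v hv huv huP hvP
      have huC : u ∉ AC := fun h => huP ⟨h, hu⟩
      have hvC : v ∉ AC := fun h => hvP ⟨h, hv⟩
      rcases cover u with h | h | h
      · have hvA := hl u v huv h hvC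
        have h1 := hf u v huv hu hv
        have h2 := hg u v huv h hvA
        simp only [hBR u h, hBR v hvA, if_false]
        have h3 : g u = f u ↔ g v = f v := by omega
        simp only [h3]
      · exact (huC h).elim
      · have hvR : v ∈ AR := by
          rcases cover v with h' | h' | h'
          · exact (hBR u (hl v u huv.symm h' huC) h).elim
          · exact (hvC h').elim
          · exact h'
        simp only [h, hvR, if_true]
    · intro v hv u hu huv huP
      have huC : u ∉ AC := fun h => huP ⟨h, hu⟩
      rcases cover v with h | h | h
      · left
        have huA := hl v u huv h huC
        have h1 := hg v u huv h huA
        simp only [hBR u huA, if_false]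
        split_ifs with h2
        · exact hpB0 v h _ (by rwa [← h2])
        · exact hpB1 v h _ (by omega)
      · exact Or.inr (hpC v h _)
      · left
        have huR : u ∈ AR := by
          rcases cover u with h' | h' | h'
          · by_cases hvC : v ∈ AC
            · exact (hCR v hvC h).elim
            · exact (hBR v (hl u v huv.symm h' hvC) h).elim
          · exact (huC h').elim
          · exact h'
        simp only [huR, if_true]
        exact hpR v h _
  have hPimage : {x : XB ⊕ XC × Fin 2 | ∃ u : XB, x = Sum.inl u ∧ u.1 ∈ P}.ncard ≤ P.ncard := by
    refine Set.ncard_le_ncard_of_injOn (Sum.elim Subtype.val fun x => x.1.1) ?_ ?_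
    · rintro _ ⟨u, rfl, hu⟩
      exact hu
    · rintro _ ⟨u, rfl, _⟩ _ ⟨u', rfl, _⟩ h
      exact congrArg Sum.inl (Subtype.ext h)
  have hT : P.ncard ≤ (auxTerminals XB XC).ncard := by
    refine (ncard_head_inter_le hX hf hg hH hcert.1).trans ?_
    have h1 : XC ⊆ Sum.elim Subtype.val (fun x => x.1.1) '' auxTerminals XB XC :=
      fun v hv => ⟨Sum.inr (⟨v, hv⟩, 0), ⟨_, rfl⟩, rfl⟩
    exact (Set.ncard_le_ncard h1).trans Set.ncard_image_le
  obtain ⟨S', hS'Z, hS'cut, hS'min⟩ := hZ (labelPartition XB XC p) ⟨_, hPcut, hPimage.trans hT⟩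
  obtain ⟨R, hRB, hSR, hRclosed, hRmem, hRpart, hRdisj⟩ := exists_regions hc hS'cut
  set S : Set V := {v | ∃ h : v ∈ XB, Sum.inl ⟨v, h⟩ ∈ S'} with hSdef
  have hSP : S.ncard ≤ P.ncard := by
    refine le_trans ?_ ((hS'min _ hPcut).trans hPimage)
    have h1 : S ⊆ (Sum.elim Subtype.val fun x => x.1.1) '' S' := by
      rintro v ⟨hv, hvS⟩
      exact ⟨_, hvS, rfl⟩
    exact (Set.ncard_le_ncard h1).trans (Set.ncard_image_le)
  -- Uncrossing the two flip cuts `S` and `P` shows that `P` avoids the region of `AR`.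
  have hSflip : IsFlipCut G XB XC AB f g S (R 0) := by
    refine ⟨fun v hv hvA u hu huv hne huS => hRmem 0 v hv u hu huv (hpB0 v hvA _ hne) huS,
      fun v hv hvA u hu huv huR heq => ?_, fun u hu v hv huv huR hvS =>
        hRclosed 0 u hu v hv huv huR hvS⟩
    exact absurd (hRpart 0 1 v hv u hu huv (hpB1 v hvA _ heq) huR) (by decide)
  have hPflip : IsFlipCut G XB XC AB f g P {u | u ∈ AB ∧ g u = f u} := isFlipCut_head hAO hf hg
  have hPR : P ∩ R 2 = ∅ := by
    have hM := hSflip.inter hPflip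
    have hN := hSflip.union_region hPflip (hRclosed 2) fun v hv hvA u hu huv huR =>
      fun heq => absurd (hRpart 2 1 v hv u hu huv (hpB1 v hvA _ heq) huR) (by decide)
    have h1 := hM.ncard_head_le hX hf hg hH hcert.1
    have h2 := hN.ncard_head_le hX hf hg hH hcert.1
    have h3 := ncard_uncross_le (S := S) (P := P) (hSR 0)
      (B := {u | u ∈ AB ∧ g u = f u}) (Set.disjoint_left.2 fun v hv hv' => hBC v hv'.1 hv.1)
      (hRdisj 0 2 (by decide)) (hSR 2)
    rw [← hPdef] at h1 h2
    rw [← Set.ncard_eq_zero]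
    omega
  have hAC : AC.ncard = P.ncard + (AC \ XB).ncard :=
    (Set.ncard_inter_add_ncard_sdiff_eq_ncard AC XB).symm
  -- The new head is optimal for `H`, and comparing sizes shows that it lies in `H`.
  have hoct := hSflip.isOCT hX hf hg hH
  have hle := hcert.1.2 _ hoct
  have hunion := Set.ncard_union_le (AC \ XB) S
  have hEq : ((AC \ XB) ∪ S) ∩ H.verts = (AC \ XB) ∪ S :=
    Set.eq_of_subset_of_ncard_le Set.inter_subset_left (by omega)
  rw [hEq] at hoct hle
  have hcard : ((AC \ XB) ∪ S).ncard = AC.ncard := by omega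
  have hopt : IsOptimalOCT H ((AC \ XB) ∪ S) := ⟨hoct, fun Y hY => hcard ▸ hcert.1.2 Y hY⟩
  set C := (AC \ XB) ∪ S with hCdef
  have hCA : C ⊆ AC ∪ AB := fun v hv => hH.1 (hoct.1 hv)
  set R' := AR \ (XB \ R 2) with hR'def
  have hR'C : Disjoint C R' := by
    rw [Set.disjoint_left]
    intro v hv hv'
    rcases hCA hv with h | h
    · exact hCR v h hv'.1
    · exact hBR v h hv'.1
  have hBsub : (C ∪ R')ᶜ ⊆ (XB ∪ AB) \ S := by
    intro v hv
    have h1 := cover v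
    have h2 := hRB 2 (a := v)
    simp only [hCdef, hR'def, Set.mem_compl_iff, Set.mem_union, Set.mem_sdiff] at hv ⊢
    tauto
  have hsub : AC ∪ AB ⊆ C ∪ (C ∪ R')ᶜ := by
    intro v hv
    have h1 : v ∉ R' := fun h => hv.elim (fun h' => hCR v h' h.1) (fun h' => hBR v h' h.1)
    simp only [Set.mem_union, Set.mem_compl_iff]
    tauto
  obtain ⟨d, hd⟩ := hSflip.exists_coloring hX hf hg
  have hocc : IsOCC G (C ∪ R')ᶜ C R' := by
    refine ⟨?_, ?_, hR'C, ?_, ?_, ?_, ?_⟩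
    · exact Set.disjoint_left.2 fun v hv hv' => hv (Or.inl hv')
    · exact Set.disjoint_left.2 fun v hv hv' => hv (Or.inr hv')
    · rw [Set.union_assoc, Set.compl_union_self]
    · exact (isBipartite_induce_iff _).2
        ⟨d, fun u v huv hu hv => hd u v huv (hBsub hu) (hBsub hv)⟩
    · intro b hb r hr hbr
      have hbS := (hBsub hb).2
      have hbR : b ∉ R' := fun h => hb (Or.inr h)
      have hbC : b ∉ C := fun h => hb (Or.inl h)
      -- If `b ∈ XB` then `b` would belong to `R 2`, and hence to `AR`, as `P` avoids `R 2`.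
      have hb2 : b ∈ XB → b ∈ R 2 → False := by
        intro hbB hb2
        rcases cover b with h | h | h
        · exact hAO.no_edge b h r hr.1 hbr
        · exact (hPR ▸ (⟨⟨h, hbB⟩, hb2⟩ : b ∈ P ∩ R 2) : b ∈ (∅ : Set V))
        · exact hbR ⟨h, fun h' => h'.2 hb2⟩
      by_cases hrB : r ∈ XB
      · have hr2 : r ∈ R 2 := by
          by_contra h
          exact hr.2 ⟨hrB, h⟩
        by_cases hbB : b ∈ XB
        · exact hb2 hbB (hRclosed 2 r hrB b hbB hbr.symm hr2 hbS)
        · exact hAO.no_edge b ((hBsub hb).1.resolve_left hbB) r hr.1 hbr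
      · by_cases hbB : b ∈ XB
        · have h1 : r ∈ XB ∪ XC ∪ XR := hX.cover ▸ Set.mem_univ r
          rcases h1 with (h1 | h1) | h1
          · exact hrB h1
          · exact hb2 hbB (hRmem 2 r h1 b hbB hbr.symm (hpR r hr.1 _) hbS)
          · exact hX.no_edge b hbB r h1 hbr
        · exact hAO.no_edge b ((hBsub hb).1.resolve_left hbB) r hr.1 hbr
    · exact hAO.nonempty.mono hsub
  have hH' : H ≤ (⊤ : G.Subgraph).induce (C ∪ (C ∪ R')ᶜ) :=
    hH.trans (SimpleGraph.Subgraph.induce_mono_right hsub)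
  have hCoct : IsOCT ((⊤ : G.Subgraph).induce (C ∪ (C ∪ R')ᶜ)) C := by
    refine isOCT_induce_iff.2 ⟨Set.subset_union_left, d, fun u v huv hu hv => ?_⟩
    exact hd u v huv (hBsub (hu.1.resolve_left hu.2)) (hBsub (hv.1.resolve_left hv.2))
  refine ⟨(C ∪ R')ᶜ, C, R', ⟨⟨hocc, (oct_induce_eq hH' hopt hCoct).symm⟩, H, hH',
    hcert.of_isOptimalOCT hopt⟩, hcard, ?_⟩
  rintro v ⟨hv | hv, hvB⟩
  · exact (hv.2 hvB).elim
  · exact ⟨hvB, hS'Z hv.2⟩
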